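/- Let $X$ be a topological space, $a,b\in X$ and $n\geq 1$. Let $\Delta^k=\{(t_1,\dots,t_k)\in\mathbb R^k\mid 0\le t_1\le\cdots\le t_k\le 1\}$, let $Y^{(n)}_{ab}\subset X^n$ be the set of all $(x_1,\dots,x_n)$ such that $x_i=x_{i+1}$ for some $i\in\{0,\dots,n\}$, where $x_0:=a$ and $x_{n+1}:=b$, and let $\mathrm H_n(X^n,Y^{(n)}_{ab})$ be relative singular homology with integer coefficients, the homology of the quotient complex $C_\bullet(X^n)/C_\bullet(Y^{(n)}_{ab})$, where $C_k(Z)$ is the free abelian group on the continuous maps $\Delta^k\to Z$. The differential is $\sigma\mapsto\sum_{i=0}^{k}(-1)^i\,\sigma\circ\partial_i$, with $\partial_i:\Delta^{k-1}\to\Delta^k$, $(t_1,\dots,t_{k-1})\mapsto(t_1,\dots,t_i,t_i,\dots,t_{k-1})$, where $t_0:=0$ and $t_k:=1$. For a path $\tilde\gamma:[0,1]\to X$ from $a$ to $b$, let $\tilde\gamma^{(n)}:\Delta^n\to X^n$ be the map $(t_1,\dots,t_n)\mapsto(\tilde\gamma(t_1),\dots,\tilde\gamma(t_n))$; it is a relative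 cycle and has a class $[\tilde\gamma^{(n)}]\in\mathrm H_n(X^n,Y^{(n)}_{ab})$. Let $\pi_1(a,b)$ be the set of homotopy classes $[\tilde\gamma]$ (with fixed endpoints) of paths from $a$ to $b$, and $\pi_1(a)=\pi_1(a,a)$. Products are those of the fundamental groupoid, with the convention that in $\gamma\cdot\alpha$ the path $\alpha$ is followed first; thus $\mathbb Z\pi_1(a,b)$ is a right module over the group ring $\mathbb Z\pi_1(a)$, whose augmentation ideal is denoted $(\mathbb Z\pi_1(a))_+$. (a) There is a unique map $F_n:\pi_1(a,b)\to\mathrm H_n(X^n,Y^{(n)}_{ab})$ such that $F_n([\tilde\gamma])=[\tilde\gamma^{(n)}]$ for every path $\tilde\gamma$ from $a$ to $b$. (b) For all $\gamma\in\pi_1(a,b)$ and $\alpha_0,\dots,\alpha_n\in\pi_1(a)$, $$\sum_{I\subset\{0,\dots,n\}}(-1)^{|I|}F_n\Big(\gamma\cdot\prod_{i\in I}\alpha_i\Big)=0$$ in $\mathrm H_n(X^n,Y^{(n)}_{ab})$, where $\prod_{i\in I}\alpha_i=\alpha_{i_1}\cdots\alpha_{i_r}$ if $I=\{i_1<\cdots<i_r\}$.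 Hence there is a unique $\mathbb Z$-linear map $$\overline F^{(n)}_{ab}:\ \mathbb Z\pi_1(a,b)\big/\,\mathbb Z\pi_1(a,b)\,(\mathbb Z\pi_1(a))_+^{\,n+1}\ \longrightarrow\ \mathrm H_n(X^n,Y^{(n)}_{ab})$$ sending the class of each $\gamma\in\pi_1(a,b)$ to $F_n(\gamma)$, where $\mathbb Z\pi_1(a,b)(\mathbb Z\pi_1(a))_+^{n+1}$ is the subgroup generated by the products $u\cdot v$ with $u\in\mathbb Z\pi_1(a,b)$ and $v\in(\mathbb Z\pi_1(a))_+^{n+1}$. -/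

import Mathlib

noncomputable section

namespace PathHomology

/-! ### Singular chains and relative singular homology -/

/-- The simplex `Δⁿ = {(t₁, …, tₙ) ∈ ℝⁿ | 0 ≤ t₁ ≤ ⋯ ≤ tₙ ≤ 1}`. -/
abbrev Simplex (n : ℕ) : Type :=
  {t : Fin n → ℝ // Monotone t ∧ ∀ i, t i ∈ Set.Icc (0 : ℝ) 1}

/-- The sequence `(x₀, x₁, …, xₙ, xₙ₊₁)` with `x₀ = a` and `xₙ₊₁ = b`. -/
def extend {Z : Type*} (a b : Z) {n : ℕ} (x : Fin n → Z) : Fin (n + 2) → Z :=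
  Fin.cons (α := fun _ => Z) a (Fin.snoc (α := fun _ => Z) x b)

/-- The sequence `(x₁, …, xᵢ, xᵢ, …, xₙ)` of length `n + 1`, with `x₀ = a` and `xₙ₊₁ = b`
(so `(a, x₁, …, xₙ)` for `i = 0` and `(x₁, …, xₙ, b)` for `i = n + 1`). -/
def dup {Z : Type*} (a b : Z) {n : ℕ} (i : Fin (n + 2)) (x : Fin n → Z) : Fin (n + 1) → Z :=
  fun j => extend a b x (if j.castSucc < i then j.succ else j.castSucc)

theorem extend_zero {Z : Type*} (a b : Z) {n : ℕ} (x : Fin n → Z) : extend a b x 0 = a := rfl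

theorem extend_last {Z : Type*} (a b : Z) {n : ℕ} (x : Fin n → Z) :
    extend a b x (Fin.last (n + 1)) = b := by
  rw [← Fin.succ_last, extend, Fin.cons_succ, Fin.snoc_last]

theorem extend_mid {Z : Type*} (a b : Z) {n : ℕ} (x : Fin n → Z) (j : Fin n) :
    extend a b x j.castSucc.succ = x j := by
  rw [extend, Fin.cons_succ, Fin.snoc_castSucc]

theorem fin_cases3 {n : ℕ} (j : Fin (n + 2)) :
    j = 0 ∨ j = Fin.last (n + 1) ∨ ∃ k : Fin n, j = k.castSucc.succ := by
  induction j using Fin.cases with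
  | zero => exact Or.inl rfl
  | succ j =>
    induction j using Fin.lastCases with
    | last => exact Or.inr (Or.inl (Fin.succ_last _))
    | cast k => exact Or.inr (Or.inr ⟨k, rfl⟩)

theorem extend_comp {Z W : Type*} (f : Z → W) (a b : Z) {n : ℕ} (x : Fin n → Z)
    (j : Fin (n + 2)) : extend (f a) (f b) (fun i => f (x i)) j = f (extend a b x j) := by
  rcases fin_cases3 j with rfl | rfl | ⟨k, rfl⟩ <;> simp only [extend_zero, extend_last, extend_mid]

theorem extend_mem {n : ℕ} (t : Simplex n) (j : Fin (n + 2)) :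
    extend (0 : ℝ) 1 t.1 j ∈ Set.Icc (0 : ℝ) 1 := by
  rcases fin_cases3 j with rfl | rfl | ⟨k, rfl⟩
  · simp [extend_zero]
  · simp [extend_last]
  · rw [extend_mid]; exact t.2.2 k

theorem extend_monotone {n : ℕ} (t : Simplex n) : Monotone (extend (0 : ℝ) 1 t.1) := by
  intro j k hjk
  rcases fin_cases3 j with rfl | rfl | ⟨j, rfl⟩
  · exact (extend_mem t k).1
  · obtain rfl : k = Fin.last (n + 1) := le_antisymm (Fin.le_last k) hjk
    exact le_rfl
  · rcases fin_cases3 k with rfl | rfl | ⟨k, rfl⟩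
    · simp at hjk
    · simpa only [extend_last] using (extend_mem t _).2
    · rw [extend_mid, extend_mid]
      exact t.2.1 (Fin.castSucc_le_castSucc_iff.1 (Fin.succ_le_succ_iff.1 hjk))

theorem val_predAbove {n : ℕ} (i : Fin n) (k : Fin (n + 1)) :
    (i.predAbove k : ℕ) = if (i : ℕ) < k then (k : ℕ) - 1 else k := by
  simp only [Fin.predAbove, Fin.lt_def, Fin.val_castSucc]
  split_ifs <;> rfl

theorem extend_dup {Z : Type*} (a b : Z) {n : ℕ} (i : Fin (n + 2)) (x : Fin n → Z)
    (k : Fin (n + 3)) : extend a b (dup a b i x) k = extend a b x (i.predAbove k) := by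
  rcases fin_cases3 k with rfl | rfl | ⟨k, rfl⟩
  · simp [extend_zero]
  · simp [extend_last]
  · rw [extend_mid, dup]
    congr 1
    ext
    rw [val_predAbove, apply_ite Fin.val]
    simp only [Fin.lt_def, Fin.val_succ, Fin.val_castSucc]
    split_ifs <;> omega

theorem continuous_dup {Z : Type*} [TopologicalSpace Z] (a b : Z) {n : ℕ} (i : Fin (n + 2)) :
    Continuous (dup a b i : (Fin n → Z) → (Fin (n + 1) → Z)) := by
  refine continuous_pi fun j => ?_
  simp only [dup]
  generalize (if j.castSucc < i then j.succ else j.castSucc) = k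
  rcases fin_cases3 k with rfl | rfl | ⟨k, rfl⟩
  · simpa only [extend_zero] using continuous_const
  · simpa only [extend_last] using continuous_const
  · simpa only [extend_mid] using continuous_apply k

/-- The `i`-th face map `Δⁿ → Δⁿ⁺¹`, `(t₁, …, tₙ) ↦ (t₁, …, tᵢ, tᵢ, …, tₙ)`, with `t₀ = 0` and
`tₙ₊₁ = 1`. -/
def face {n : ℕ} (i : Fin (n + 2)) : C(Simplex n, Simplex (n + 1)) where
  toFun t := ⟨dup 0 1 i t.1, by
    refine ⟨fun j k hjk => extend_monotone t ?_, fun j => extend_mem t _⟩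
    split_ifs <;> simp_all only [Fin.le_def, Fin.lt_def, Fin.val_succ, Fin.val_castSucc] <;> omega⟩
  continuous_toFun :=
    Continuous.subtype_mk ((continuous_dup (0 : ℝ) 1 i).comp continuous_subtype_val) _

/-- Singular `n`-chains with integer coefficients. -/
abbrev Chains (Z : Type*) [TopologicalSpace Z] (n : ℕ) : Type _ :=
  C(Simplex n, Z) →₀ ℤ

/-- The singular differential `Cₙ₊₁(Z) → Cₙ(Z)`, `σ ↦ ∑ᵢ (-1)ⁱ σ ∘ ∂ᵢ`. -/
def boundary (Z : Type*) [TopologicalSpace Z] (n : ℕ) : Chains Z (n + 1) →ₗ[ℤ] Chains Z n :=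
  Finsupp.linearCombination ℤ fun σ : C(Simplex (n + 1), Z) =>
    ∑ i : Fin (n + 2), (-1 : ℤ) ^ (i : ℕ) • Finsupp.single (σ.comp (face i)) (1 : ℤ)

theorem dup_dup {Z : Type*} (a b : Z) {n : ℕ} (i j : Fin (n + 2)) (h : i ≤ j) (x : Fin n → Z) :
    dup a b j.succ (dup a b i x) = dup a b i.castSucc (dup a b j x) := by
  funext k
  rw [dup, extend_dup, dup, extend_dup]
  congr 1
  ext
  rw [val_predAbove, val_predAbove, apply_ite Fin.val, apply_ite Fin.val]
  simp only [Fin.lt_def, Fin.le_def, Fin.val_succ, Fin.val_castSucc] at *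
  split_ifs <;> omega

theorem face_face {n : ℕ} (i j : Fin (n + 2)) (h : i ≤ j) :
    (face j.succ).comp (face i) = (face i.castSucc).comp (face j) :=
  ContinuousMap.ext fun t => Subtype.ext (dup_dup 0 1 i j h t.1)

/-- The square of the singular differential is zero. -/
theorem boundary_boundary (Z : Type*) [TopologicalSpace Z] (n : ℕ) (c : Chains Z (n + 2)) :
    boundary Z n (boundary Z (n + 1) c) = 0 := by
  induction c using Finsupp.induction_linear with
  | zero => simp
  | add c d hc hd => rw [map_add, map_add, hc, hd, add_zero]
  | single σ m =>
    simp only [boundary, Finsupp.linearCombination_single, map_smul, map_sum, one_smul,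
      Finset.smul_sum]
    rw [← Finset.sum_product', Finset.univ_product_univ,
      ← Finset.sum_filter_add_sum_filter_not _ (fun p : Fin (n + 3) × Fin (n + 2) =>
        (p.2 : ℕ) < p.1), ← eq_neg_iff_add_eq_zero, ← Finset.sum_neg_distrib]
    refine Finset.sum_bij' (i := fun p hp => (p.2.castSucc, p.1.pred (by
        rintro h; simp [h] at hp)))
      (j := fun p hp => (p.2.succ, p.1.castLT (by
        have := p.2.2; simp at hp; omega))) ?_ ?_ ?_ ?_ ?_
    · rintro ⟨i, j⟩ hp
      simp at hp ⊢
      omega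
    · rintro ⟨i, j⟩ hp
      simp at hp ⊢
      omega
    · rintro ⟨i, j⟩ hp
      simp
    · rintro ⟨i, j⟩ hp
      simp
    · rintro ⟨i, j⟩ hp
      obtain ⟨i, rfl⟩ : ∃ i', i = Fin.succ i' := ⟨i.pred (by rintro h; simp [h] at hp), by simp⟩
      have hji : j ≤ i := by
        simp at hp
        exact Fin.le_def.2 (by omega)
      simp only [ContinuousMap.comp_assoc, face_face j i hji, Fin.pred_succ, Fin.val_succ,
        Fin.val_castSucc, pow_succ, smul_smul, ← neg_smul]
      congr 1
      ring

/-- The chains of the subspace `Y`, as a submodule of the chains of `Z`: the combinations of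
singular simplices with image in `Y`. -/
def subChains {Z : Type*} [TopologicalSpace Z] (Y : Set Z) (n : ℕ) : Submodule ℤ (Chains Z n) :=
  Finsupp.supported ℤ ℤ {σ : C(Simplex n, Z) | ∀ t, σ t ∈ Y}

theorem subChains_le_comap {Z : Type*} [TopologicalSpace Z] (Y : Set Z) (n : ℕ) :
    subChains Y (n + 1) ≤ (subChains Y n).comap (boundary Z n) := by
  rw [subChains, Finsupp.supported_eq_span_single, Submodule.span_le]
  rintro _ ⟨σ, hσ, rfl⟩
  simp only [SetLike.mem_coe, Submodule.mem_comap, boundary, Finsupp.linearCombination_single,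
    one_smul]
  exact Submodule.sum_mem _ fun i _ => Submodule.smul_mem _ _
    (Finsupp.single_mem_supported ℤ 1 fun t => hσ _)

/-- Relative chains `Cₙ(Z) / Cₙ(Y)`. -/
abbrev RelChains {Z : Type*} [TopologicalSpace Z] (Y : Set Z) (n : ℕ) : Type _ :=
  Chains Z n ⧸ subChains Y n

/-- The differential of the quotient complex. -/
def relBoundary {Z : Type*} [TopologicalSpace Z] (Y : Set Z) (n : ℕ) :
    RelChains Y (n + 1) →ₗ[ℤ] RelChains Y n :=
  Submodule.mapQ _ _ (boundary Z n) (subChains_le_comap Y n)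

/-- Cycles of the quotient complex (the complex is zero in degree `-1`). -/
def relCycles {Z : Type*} [TopologicalSpace Z] (Y : Set Z) :
    (n : ℕ) → Submodule ℤ (RelChains Y n)
  | 0 => ⊤
  | n + 1 => LinearMap.ker (relBoundary Y n)

/-- Boundaries of the quotient complex. -/
def relBoundaries {Z : Type*} [TopologicalSpace Z] (Y : Set Z) (n : ℕ) :
    Submodule ℤ (RelChains Y n) :=
  LinearMap.range (relBoundary Y n)

/-- Relative singular homology `Hₙ(Z, Y)` with integer coefficients: cycles modulo boundaries in the
quotient complex. -/
abbrev RelHomology {Z : Type*} [TopologicalSpace Z] (Y : Set Z) (n : ℕ) : Type _ :=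
  relCycles Y n ⧸ (relBoundaries Y n).submoduleOf (relCycles Y n)

/-! ### The class of a path -/

/-- The subset `{x ∈ Xⁿ | ∃ i ∈ {0, …, n}, xᵢ = xᵢ₊₁}` of `Xⁿ`, with `x₀ = a` and `xₙ₊₁ = b`. -/
def diag {X : Type*} (a b : X) (n : ℕ) : Set (Fin n → X) :=
  ⋃ i : Fin (n + 1), {x | extend a b x i.castSucc = extend a b x i.succ}

/-- The restriction `Δⁿ → Xⁿ`, `(t₁, …, tₙ) ↦ (γ t₁, …, γ tₙ)`, of `γⁿ` to the simplex. -/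
def pathSimplex {X : Type*} [TopologicalSpace X] {a b : X} (n : ℕ) (γ : Path a b) :
    C(Simplex n, Fin n → X) where
  toFun t i := γ ⟨t.1 i, t.2.2 i⟩
  continuous_toFun := continuous_pi fun i => γ.continuous.comp
    (Continuous.subtype_mk ((continuous_apply i).comp continuous_subtype_val) _)

theorem pathSimplex_face_mem {X : Type*} [TopologicalSpace X] {a b : X} (n : ℕ) (γ : Path a b)
    (i : Fin (n + 2)) (t : Simplex n) :
    pathSimplex (n + 1) γ (face i t) ∈ diag a b (n + 1) := by
  have h : pathSimplex (n + 1) γ (face i t) = dup a b i (pathSimplex n γ t) := by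
    funext j
    have h1 : ∀ m (u : Simplex m) k, pathSimplex m γ u k = γ.extend (u.1 k) := fun m u k =>
      (γ.extend_apply (u.2.2 k)).symm
    have h2 : pathSimplex n γ t = fun k => γ.extend (t.1 k) := funext (h1 n t)
    have h3 := extend_comp γ.extend 0 1 t.1 (if j.castSucc < i then j.succ else j.castSucc)
    rw [γ.extend_zero, γ.extend_one] at h3
    rw [h1, h2, dup, h3]
    rfl
  rw [h]
  refine Set.mem_iUnion.2 ⟨i, ?_⟩
  simp [extend_dup]

theorem pathSimplex_mem_relCycles {X : Type*} [TopologicalSpace X] {a b : X} (n : ℕ)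
    (γ : Path a b) :
    (Submodule.Quotient.mk (Finsupp.single (pathSimplex n γ) (1 : ℤ)) : RelChains (diag a b n) n) ∈
      relCycles (diag a b n) n := by
  cases n with
  | zero => exact Submodule.mem_top
  | succ n =>
    rw [relCycles, LinearMap.mem_ker, relBoundary, Submodule.mapQ_apply,
      Submodule.Quotient.mk_eq_zero, boundary, Finsupp.linearCombination_single, one_smul]
    exact Submodule.sum_mem _ fun i _ => Submodule.smul_mem _ _
      (Finsupp.single_mem_supported ℤ 1 fun t => pathSimplex_face_mem n γ i t)

/-- The class `[γ⁽ⁿ⁾]` in the relative homology group `Hₙ(Xⁿ, Y)`, `Y = diag a b n`. -/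
def pathClass {X : Type*} [TopologicalSpace X] {a b : X} (n : ℕ) (γ : Path a b) :
    RelHomology (diag a b n) n :=
  Submodule.Quotient.mk ⟨Submodule.Quotient.mk (Finsupp.single (pathSimplex n γ) (1 : ℤ)),
    pathSimplex_mem_relCycles n γ⟩

/-! ### Homotopy classes of paths as a right module over the group ring -/

/-- The product `γ · α` in the fundamental groupoid, for `γ ∈ π₁(a, b)` and `α ∈ π₁(a)`: the loop
`α` is followed first, then `γ`. With the multiplication of `FundamentalGroup X a` in Mathlib
(in `α * β` the loop `β` is followed first) it is a right action. -/
def pathMul {X : Type*} [TopologicalSpace X] {a b : X} (γ : Path.Homotopic.Quotient a b)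
    (α : FundamentalGroup X a) : Path.Homotopic.Quotient a b :=
  (FundamentalGroup.toPath α).trans γ

theorem pathMul_mul {X : Type*} [TopologicalSpace X] {a b : X} (γ : Path.Homotopic.Quotient a b)
    (α β : FundamentalGroup X a) : pathMul γ (α * β) = pathMul (pathMul γ α) β :=
  Path.Homotopic.Quotient.trans_assoc β α γ

/-- The `ℤ`-bilinear extension of `pathMul`: the right action of the group ring `ℤπ₁(a)` on the free
`ℤ`-module `ℤπ₁(a, b)`. -/
def rightMul {X : Type*} [TopologicalSpace X] (a b : X) :
    (Path.Homotopic.Quotient a b →₀ ℤ) →ₗ[ℤ] MonoidAlgebra ℤ (FundamentalGroup X a) →ₗ[ℤ]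
      (Path.Homotopic.Quotient a b →₀ ℤ) :=
  Finsupp.linearCombination ℤ fun γ =>
    (Finsupp.linearCombination ℤ fun α : FundamentalGroup X a =>
      Finsupp.single (pathMul γ α) (1 : ℤ)) ∘ₗ (MonoidAlgebra.coeffLinearEquiv ℤ).toLinearMap

/-- The augmentation ideal of an integral group ring. -/
def augIdeal (G : Type*) [Group G] : Ideal (MonoidAlgebra ℤ G) :=
  RingHom.ker (MonoidAlgebra.lift ℤ ℤ G 1)

/-- The submodule `ℤπ₁(a, b) · (ℤπ₁(a))₊ᵐ` of `ℤπ₁(a, b)`, spanned by the products `u · v` with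
`u ∈ ℤπ₁(a, b)` and `v` in the `m`-th power of the augmentation ideal. -/
def augSubmodule {X : Type*} [TopologicalSpace X] (a b : X) (m : ℕ) :
    Submodule ℤ (Path.Homotopic.Quotient a b →₀ ℤ) :=
  Submodule.map₂ (rightMul a b) ⊤ ((augIdeal (FundamentalGroup X a) ^ m).restrictScalars ℤ)

end PathHomology

end

noncomputable section

namespace PathHomology

/-! ### The augmented complex of tuples -/

/-! Extend a path constantly to `ℝ`; then `pathSimplex n γ` is the inclusion of the simplex in `ℝⁿ`
followed by `γ` on each coordinate. Chains are built from tuples of points, realized as affine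
simplices, and all homotopies between them are iterated cones (`tupleBoundary_coneHomotopy`).

For (a), a homotopy of paths is a map on `ℝ × ℝⁿ`, and `exists_prism` provides the prism. Since
endpoints stay fixed, the walls of the prism land in `diag`.

For (b), replace each omitted loop by a constant one, so that all `2ⁿ⁺¹` concatenated paths share
the same breakpoints. Subdividing the simplex along the hyperplanes "a coordinate equals a
breakpoint" (`exists_forall_oneSided`) gives one chain that serves every `I`. On a piece of it each
of the `n` coordinates stays between consecutive breakpoints and sees at most one loop. There are `n
+ 1` loops, so some loop `l` is unseen, and the terms of `I` and `I ∪ {l}` cancel. The alternating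
sum thus vanishes already on chains (`sum_realize_concat`).

The factorization follows because powers of the augmentation ideal are additively spanned by
products of elements `1 - g`, whose expansions are these alternating sums. -/

/-- Formal integral combinations of `m`-tuples of elements of `E`. -/
abbrev TupleChains (E : Type*) (m : ℕ) : Type _ := (Fin m → E) →₀ ℤ

/-- The augmented differential, the alternating sum of the maps that omit an entry. -/
def tupleBoundary (E : Type*) (m : ℕ) : TupleChains E (m + 1) →ₗ[ℤ] TupleChains E m :=
  Finsupp.linearCombination ℤ fun σ : Fin (m + 1) → E =>
    ∑ i : Fin (m + 1), (-1 : ℤ) ^ (i : ℕ) • Finsupp.single (fun j => σ (i.succAbove j)) (1 : ℤ)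

theorem tupleBoundary_single {E : Type*} {m : ℕ} (σ : Fin (m + 1) → E) :
    tupleBoundary E m (Finsupp.single σ 1) = ∑ i : Fin (m + 1),
      (-1 : ℤ) ^ (i : ℕ) • Finsupp.single (fun j => σ (i.succAbove j)) (1 : ℤ) := by
  rw [tupleBoundary, Finsupp.linearCombination_single, one_smul]

/-- The cone with apex `q`. -/
def cone {E : Type*} (q : E) (m : ℕ) : TupleChains E m →ₗ[ℤ] TupleChains E (m + 1) :=
  Finsupp.lmapDomain ℤ ℤ fun σ => Fin.cons (α := fun _ => E) q σ

theorem cone_single {E : Type*} (q : E) {m : ℕ} (σ : Fin m → E) (k : ℤ) :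
    cone q m (Finsupp.single σ k) = Finsupp.single (Fin.cons (α := fun _ => E) q σ) k := by
  simp [cone]

theorem tupleChains_hom_ext {E M : Type*} [AddCommGroup M] {m : ℕ}
    {f g : TupleChains E m →ₗ[ℤ] M}
    (h : ∀ σ, f (Finsupp.single σ 1) = g (Finsupp.single σ 1)) : f = g :=
  Finsupp.lhom_ext' fun σ => LinearMap.ext_ring (h σ)

theorem tupleBoundary_cone_zero {E : Type*} (q : E) (c : TupleChains E 0) :
    tupleBoundary E 0 (cone q 0 c) = c := by
  suffices h : tupleBoundary E 0 ∘ₗ cone q 0 = LinearMap.id from LinearMap.congr_fun h c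
  refine tupleChains_hom_ext fun σ => ?_
  simp only [LinearMap.comp_apply, cone_single, tupleBoundary_single, LinearMap.id_apply]
  rw [Fin.sum_univ_succ, Fin.sum_univ_zero, add_zero, Fin.val_zero, pow_zero, one_smul]
  congr 1

/-- Omitting the apex returns the tuple; omitting entry `i` of the tuple omits entry `i + 1` of the
cone, whence the minus sign. In particular the cone over a cycle bounds that cycle. -/
theorem tupleBoundary_cone_succ {E : Type*} (q : E) (m : ℕ) (c : TupleChains E (m + 1)) :
    tupleBoundary E (m + 1) (cone q (m + 1) c) = c - cone q m (tupleBoundary E m c) := by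
  suffices h : tupleBoundary E (m + 1) ∘ₗ cone q (m + 1) =
      LinearMap.id - cone q m ∘ₗ tupleBoundary E m from LinearMap.congr_fun h c
  refine tupleChains_hom_ext fun σ => ?_
  simp only [LinearMap.comp_apply, LinearMap.sub_apply, cone_single, tupleBoundary_single,
    LinearMap.id_apply, map_sum, map_smul]
  rw [Fin.sum_univ_succ, sub_eq_add_neg, ← Finset.sum_neg_distrib]
  congr 1
  · simp
  · refine Finset.sum_congr rfl fun i _ => ?_
    rw [Fin.val_succ, pow_succ, mul_neg_one, neg_smul]
    congr 3
    funext j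
    induction j using Fin.cases with
    | zero => simp
    | succ j => simp

/-- Every nonempty tuple is a cone over its tail, so the cone formula and induction replace the
usual double-sum cancellation. -/
theorem tupleBoundary_tupleBoundary (E : Type*) (m : ℕ) (c : TupleChains E (m + 2)) :
    tupleBoundary E m (tupleBoundary E (m + 1) c) = 0 := by
  suffices h : ∀ m, tupleBoundary E m ∘ₗ tupleBoundary E (m + 1) = 0 from
    LinearMap.congr_fun (h m) c
  intro m
  induction m with
  | zero =>
    refine tupleChains_hom_ext fun σ => ?_
    rw [← Fin.cons_self_tail σ, ← cone_single, LinearMap.comp_apply, tupleBoundary_cone_succ,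
      map_sub, tupleBoundary_cone_zero, sub_self, LinearMap.zero_apply]
  | succ m ih =>
    refine tupleChains_hom_ext fun σ => ?_
    rw [← Fin.cons_self_tail σ, ← cone_single, LinearMap.comp_apply, tupleBoundary_cone_succ,
      map_sub, tupleBoundary_cone_succ, ← LinearMap.comp_apply (tupleBoundary E m), ih]
    simp

/-- The chains whose tuples have all their entries in `C`. -/
def carriedBy {E : Type*} (C : Set E) (m : ℕ) : Submodule ℤ (TupleChains E m) :=
  Finsupp.supported ℤ ℤ {σ | ∀ j, σ j ∈ C}

theorem single_mem_carriedBy {E : Type*} {C : Set E} {m : ℕ} {σ : Fin m → E}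
    (h : ∀ j, σ j ∈ C) : Finsupp.single σ (1 : ℤ) ∈ carriedBy C m :=
  Finsupp.single_mem_supported ℤ 1 h

theorem map_mem_of_mem_supported {α M : Type*} [AddCommGroup M] {s : Set α}
    {f : (α →₀ ℤ) →ₗ[ℤ] M} {N : Submodule ℤ M} (h : ∀ x ∈ s, f (Finsupp.single x 1) ∈ N)
    {c : α →₀ ℤ} (hc : c ∈ Finsupp.supported ℤ ℤ s) : f c ∈ N := by
  have : Finsupp.supported ℤ ℤ s ≤ N.comap f := by
    rw [Finsupp.supported_eq_span_single, Submodule.span_le]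
    rintro _ ⟨x, hx, rfl⟩
    exact h x hx
  exact this hc

theorem cone_mem_carriedBy {E : Type*} {C : Set E} {q : E} (hq : q ∈ C) {m : ℕ}
    {c : TupleChains E m} (hc : c ∈ carriedBy C m) : cone q m c ∈ carriedBy C (m + 1) := by
  refine map_mem_of_mem_supported (fun σ hσ => ?_) hc
  rw [cone_single]
  exact single_mem_carriedBy fun j => Fin.cases hq hσ j

theorem tupleBoundary_mem_carriedBy {E : Type*} {C : Set E} {m : ℕ}
    {c : TupleChains E (m + 1)} (hc : c ∈ carriedBy C (m + 1)) :
    tupleBoundary E m c ∈ carriedBy C m := by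
  refine map_mem_of_mem_supported (fun σ hσ => ?_) hc
  rw [tupleBoundary_single]
  exact Submodule.sum_mem _ fun i _ => Submodule.smul_mem _ _
    (single_mem_carriedBy fun j => hσ _)

/-! ### Contracting a chain map by cones -/

/-- The null-homotopy of a chain map `φ` built from cones with apices `q σ`. -/
def coneHomotopy {E E' : Type*} (φ : ∀ m, TupleChains E m →ₗ[ℤ] TupleChains E' m)
    (q : ∀ m, (Fin (m + 1) → E) → E') : ∀ m, TupleChains E m →ₗ[ℤ] TupleChains E' (m + 1)
  | 0 => 0
  | m + 1 => Finsupp.linearCombination ℤ fun σ : Fin (m + 1) → E =>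
      cone (q m σ) (m + 1) (φ (m + 1) (Finsupp.single σ 1) -
        coneHomotopy φ q m (tupleBoundary E m (Finsupp.single σ 1)))

theorem coneHomotopy_succ_single {E E' : Type*}
    (φ : ∀ m, TupleChains E m →ₗ[ℤ] TupleChains E' m) (q : ∀ m, (Fin (m + 1) → E) → E') (m : ℕ)
    (σ : Fin (m + 1) → E) : coneHomotopy φ q (m + 1) (Finsupp.single σ 1) =
      cone (q m σ) (m + 1) (φ (m + 1) (Finsupp.single σ 1) -
        coneHomotopy φ q m (tupleBoundary E m (Finsupp.single σ 1))) := by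
  rw [coneHomotopy, Finsupp.linearCombination_single, one_smul]

/-- By induction the chain being coned off is a cycle, so the cone formula returns it unchanged. The
recursion starts from zero, which is why `φ 0 = 0` is required. -/
theorem tupleBoundary_coneHomotopy {E E' : Type*}
    {φ : ∀ m, TupleChains E m →ₗ[ℤ] TupleChains E' m} (q : ∀ m, (Fin (m + 1) → E) → E')
    (hφ : ∀ m c, tupleBoundary E' m (φ (m + 1) c) = φ m (tupleBoundary E m c)) (h0 : φ 0 = 0)
    (m : ℕ) (c : TupleChains E (m + 1)) :
    tupleBoundary E' (m + 1) (coneHomotopy φ q (m + 1) c) =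
      φ (m + 1) c - coneHomotopy φ q m (tupleBoundary E m c) := by
  suffices h : ∀ m, tupleBoundary E' (m + 1) ∘ₗ coneHomotopy φ q (m + 1) =
      φ (m + 1) - coneHomotopy φ q m ∘ₗ tupleBoundary E m from LinearMap.congr_fun (h m) c
  intro m
  induction m with
  | zero =>
    refine tupleChains_hom_ext fun σ => ?_
    simp only [LinearMap.comp_apply, LinearMap.sub_apply, coneHomotopy_succ_single,
      tupleBoundary_cone_succ, sub_eq_self]
    simp [coneHomotopy, hφ, h0]
  | succ m ih =>
    refine tupleChains_hom_ext fun σ => ?_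
    simp only [LinearMap.comp_apply, LinearMap.sub_apply, coneHomotopy_succ_single φ q (m + 1),
      tupleBoundary_cone_succ, sub_eq_self]
    have h := LinearMap.congr_fun ih (tupleBoundary E (m + 1) (Finsupp.single σ 1))
    simp only [LinearMap.comp_apply, LinearMap.sub_apply, tupleBoundary_tupleBoundary, map_zero,
      sub_zero] at h
    rw [map_sub, h, hφ, sub_self, map_zero]

/-- The homotopy does not depend on `C`, so a single one respects a whole family of subsets; this
makes it a homotopy of relative chains. -/
theorem coneHomotopy_mem_carriedBy {E E' : Type*}
    {φ : ∀ m, TupleChains E m →ₗ[ℤ] TupleChains E' m} {q : ∀ m, (Fin (m + 1) → E) → E'}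
    {C : Set E} {C' : Set E'} (hφ : ∀ m, ∀ c ∈ carriedBy C m, φ m c ∈ carriedBy C' m)
    (hq : ∀ m σ, (∀ j, σ j ∈ C) → q m σ ∈ C') (m : ℕ) :
    ∀ c ∈ carriedBy C m, coneHomotopy φ q m c ∈ carriedBy C' (m + 1) := by
  induction m with
  | zero => intro c _; exact Submodule.zero_mem _
  | succ m ih =>
    intro c hc
    refine map_mem_of_mem_supported (fun σ hσ => ?_) hc
    rw [coneHomotopy_succ_single]
    exact cone_mem_carriedBy (hq m σ hσ) (Submodule.sub_mem _ (hφ _ _ (single_mem_carriedBy hσ))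
      (ih _ (tupleBoundary_mem_carriedBy (single_mem_carriedBy hσ))))

/-! ### Cutting tuples along a hyperplane -/

/-- The entries of the tuple lie on one side of the hyperplane `f = b`. -/
def OneSided {E : Type*} (f : E → ℝ) (b : ℝ) {m : ℕ} (σ : Fin m → E) : Prop :=
  (∀ j, f (σ j) ≤ b) ∨ ∀ j, b ≤ f (σ j)

theorem OneSided.comp {E : Type*} {f : E → ℝ} {b : ℝ} {m k : ℕ} {σ : Fin m → E} (h : OneSided f b σ)
    (s : Fin k → Fin m) : OneSided f b fun j => σ (s j) :=
  h.imp (fun h _ => h _) fun h _ => h _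

/-- The quantifier over `C` sits inside the existential: one point must lie in every convex set
containing the tuple, so that cutting respects all faces at once. -/
theorem exists_cutPoint {E : Type*} [AddCommGroup E] [Module ℝ E] (f : E →ₗ[ℝ] ℝ) (b : ℝ)
    {m : ℕ} (σ : Fin (m + 1) → E) : ∃ q : E, (∀ C : Set E, Convex ℝ C → (∀ j, σ j ∈ C) → q ∈ C) ∧
      (¬ OneSided f b σ → f q = b) := by
  by_cases h : OneSided f b σ
  -- The value still matters for a one-sided tuple, since `coneHomotopy` uses it as an apex there
  -- too.
  · exact ⟨σ 0, fun C _ hC => hC 0, fun h' => absurd h h'⟩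
  · simp only [OneSided, not_or, not_forall, not_le] at h
    obtain ⟨⟨i, hi⟩, j, hj⟩ := h
    have hd : 0 < f (σ i) - f (σ j) := by linarith
    -- The point where the segment from `σ i` to `σ j` meets the hyperplane.
    refine ⟨((b - f (σ j)) / (f (σ i) - f (σ j))) • σ i +
      ((f (σ i) - b) / (f (σ i) - f (σ j))) • σ j, fun C hC hσ => ?_, fun _ => ?_⟩
    · refine hC (hσ i) (hσ j) (div_nonneg (by linarith) hd.le) (div_nonneg (by linarith) hd.le) ?_
      field_simp
      ring
    · rw [map_add, map_smul, map_smul, smul_eq_mul, smul_eq_mul]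
      field_simp
      ring

/-- A point of the hyperplane `f = b` in the convex hull of a tuple that crosses it. -/
def cutPoint {E : Type*} [AddCommGroup E] [Module ℝ E] (f : E →ₗ[ℝ] ℝ) (b : ℝ)
    (m : ℕ) (σ : Fin (m + 1) → E) : E :=
  (exists_cutPoint f b σ).choose

theorem cutPoint_mem {E : Type*} [AddCommGroup E] [Module ℝ E] (f : E →ₗ[ℝ] ℝ) (b : ℝ)
    {m : ℕ} {σ : Fin (m + 1) → E} {C : Set E} (hC : Convex ℝ C) (hσ : ∀ j, σ j ∈ C) :
    cutPoint f b m σ ∈ C :=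
  (exists_cutPoint f b σ).choose_spec.1 C hC hσ

theorem map_cutPoint {E : Type*} [AddCommGroup E] [Module ℝ E] {f : E →ₗ[ℝ] ℝ} {b : ℝ}
    {m : ℕ} {σ : Fin (m + 1) → E} (h : ¬ OneSided f b σ) : f (cutPoint f b m σ) = b :=
  (exists_cutPoint f b σ).choose_spec.2 h

open Classical in
/-- Subdivision of tuples along the hyperplane `f = b`. -/
def cut {E : Type*} [AddCommGroup E] [Module ℝ E] (f : E →ₗ[ℝ] ℝ) (b : ℝ) :
    ∀ m, TupleChains E m →ₗ[ℤ] TupleChains E m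
  | 0 => LinearMap.id
  | m + 1 => Finsupp.linearCombination ℤ fun σ : Fin (m + 1) → E =>
      if OneSided f b σ then Finsupp.single σ 1
      else cone (cutPoint f b m σ) m (cut f b m (tupleBoundary E m (Finsupp.single σ 1)))

section Cut

variable {E : Type*} [AddCommGroup E] [Module ℝ E] (f : E →ₗ[ℝ] ℝ) (b : ℝ)

theorem cut_single_of_oneSided {m : ℕ} {σ : Fin m → E} (h : OneSided f b σ) :
    cut f b m (Finsupp.single σ 1) = Finsupp.single σ 1 := by
  cases m with
  | zero => rfl
  | succ m => rw [cut, Finsupp.linearCombination_single, one_smul, if_pos h]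

theorem cut_single_of_not_oneSided {m : ℕ} {σ : Fin (m + 1) → E} (h : ¬ OneSided f b σ) :
    cut f b (m + 1) (Finsupp.single σ 1) =
      cone (cutPoint f b m σ) m (cut f b m (tupleBoundary E m (Finsupp.single σ 1))) := by
  rw [cut, Finsupp.linearCombination_single, one_smul, if_neg h]

theorem cut_tupleBoundary_of_oneSided {m : ℕ} {σ : Fin (m + 1) → E} (h : OneSided f b σ) :
    cut f b m (tupleBoundary E m (Finsupp.single σ 1)) =
      tupleBoundary E m (Finsupp.single σ 1) := by
  simp only [tupleBoundary_single, map_sum, map_smul]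
  exact Finset.sum_congr rfl fun i _ => by rw [cut_single_of_oneSided f b (h.comp _)]

theorem tupleBoundary_cut (m : ℕ) (c : TupleChains E (m + 1)) :
    tupleBoundary E m (cut f b (m + 1) c) = cut f b m (tupleBoundary E m c) := by
  suffices h : ∀ m, tupleBoundary E m ∘ₗ cut f b (m + 1) = cut f b m ∘ₗ tupleBoundary E m from
    LinearMap.congr_fun (h m) c
  intro m
  induction m with
  | zero =>
    refine tupleChains_hom_ext fun σ => ?_
    -- A single point is never cut.
    have h : OneSided f b σ :=
      (le_total (f (σ 0)) b).imp (fun h j => by rwa [Fin.fin_one_eq_zero j])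
        fun h j => by rwa [Fin.fin_one_eq_zero j]
    rw [LinearMap.comp_apply, LinearMap.comp_apply, cut_single_of_oneSided f b h,
      cut_tupleBoundary_of_oneSided f b h]
  | succ m ih =>
    refine tupleChains_hom_ext fun σ => ?_
    rw [LinearMap.comp_apply, LinearMap.comp_apply]
    by_cases h : OneSided f b σ
    · rw [cut_single_of_oneSided f b h, cut_tupleBoundary_of_oneSided f b h]
    · have h' := LinearMap.congr_fun ih (tupleBoundary E (m + 1) (Finsupp.single σ 1))
      rw [LinearMap.comp_apply, LinearMap.comp_apply, tupleBoundary_tupleBoundary, map_zero] at h'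
      rw [cut_single_of_not_oneSided f b h, tupleBoundary_cone_succ, h', map_zero, sub_zero]

theorem cut_mem_carriedBy {C : Set E} (hC : Convex ℝ C) (m : ℕ) :
    ∀ c ∈ carriedBy C m, cut f b m c ∈ carriedBy C m := by
  induction m with
  | zero => exact fun c hc => hc
  | succ m ih =>
    intro c hc
    refine map_mem_of_mem_supported (fun σ hσ => ?_) hc
    by_cases h : OneSided f b σ
    · rw [cut_single_of_oneSided f b h]
      exact single_mem_carriedBy hσ
    · rw [cut_single_of_not_oneSided f b h]
      exact cone_mem_carriedBy (cutPoint_mem f b hC hσ)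
        (ih _ (tupleBoundary_mem_carriedBy (single_mem_carriedBy hσ)))

/-- The apex of each new cone is on the hyperplane, so coning keeps a one-sided tuple on its side.
-/
theorem cut_mem_oneSided (m : ℕ) (c : TupleChains E m) :
    cut f b m c ∈ Finsupp.supported ℤ ℤ {σ : Fin m → E | OneSided f b σ} := by
  induction m with
  | zero =>
    rw [show {σ : Fin 0 → E | OneSided f b σ} = Set.univ from
      Set.eq_univ_of_forall fun σ => Or.inl fun j => j.elim0, Finsupp.supported_univ]
    exact Submodule.mem_top
  | succ m ih =>
    refine map_mem_of_mem_supported (s := Set.univ) (fun σ _ => ?_)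
      (by rw [Finsupp.supported_univ]; exact Submodule.mem_top)
    by_cases h : OneSided f b σ
    · rw [cut_single_of_oneSided f b h]
      exact Finsupp.single_mem_supported ℤ 1 h
    · rw [cut_single_of_not_oneSided f b h]
      refine map_mem_of_mem_supported (fun τ hτ => ?_) (ih _)
      rw [cone_single]
      have hq := map_cutPoint h
      exact Finsupp.single_mem_supported ℤ 1 (hτ.imp (fun h j => Fin.cases hq.le h j)
        fun h j => Fin.cases hq.ge h j)

/-- The subdivision preserves one-sidedness with respect to other hyperplanes. -/
theorem cut_mem_forall_oneSided (l : List ((E →ₗ[ℝ] ℝ) × ℝ)) {m : ℕ} {c : TupleChains E m}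
    (hc : c ∈ Finsupp.supported ℤ ℤ {σ : Fin m → E | ∀ p ∈ l, OneSided p.1 p.2 σ}) :
    cut f b m c ∈ Finsupp.supported ℤ ℤ {σ : Fin m → E | ∀ p ∈ l, OneSided p.1 p.2 σ} := by
  refine map_mem_of_mem_supported (fun σ hσ => ?_) hc
  rw [Finsupp.mem_supported]
  intro τ hτ p hp
  -- Each side of another hyperplane is a convex half-space, and cutting preserves chains carried by
  -- a convex set.
  refine (hσ p hp).imp (fun h => ?_) fun h => ?_
  · exact cut_mem_carriedBy f b (convex_halfSpace_le p.1.isLinear p.2) m _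
      (single_mem_carriedBy h) hτ
  · exact cut_mem_carriedBy f b (convex_halfSpace_ge p.1.isLinear p.2) m _
      (single_mem_carriedBy h) hτ

/-- A relative cycle of tuples, relative to convex subsets `C i`, is homologous to one that does
not cross any of finitely many given hyperplanes. -/
theorem exists_forall_oneSided {ι : Type*} {C : ι → Set E} (hC : ∀ i, Convex ℝ (C i))
    (l : List ((E →ₗ[ℝ] ℝ) × ℝ)) {m : ℕ} (c : TupleChains E (m + 1))
    (hc : tupleBoundary E m c ∈ ⨆ i, carriedBy (C i) m) :
    ∃ c' : TupleChains E (m + 1),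
      c' ∈ Finsupp.supported ℤ ℤ {σ : Fin (m + 1) → E | ∀ p ∈ l, OneSided p.1 p.2 σ} ∧
      tupleBoundary E m c' ∈ ⨆ i, carriedBy (C i) m ∧
      ∃ e, c - c' - tupleBoundary E (m + 1) e ∈ ⨆ i, carriedBy (C i) (m + 1) := by
  induction l with
  | nil =>
    refine ⟨c, ?_, hc, 0, by simp⟩
    simp [Finsupp.supported_univ]
  | cons p l ih =>
    obtain ⟨c', h1, h2, e, he⟩ := ih
    -- Here `c' - cut c' = ∂Tc' + T∂c'` with `T` the cone homotopy of `φ`; the last term is carried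
    -- by the `C i` because `∂c'` is.
    let φ : ∀ m, TupleChains E m →ₗ[ℤ] TupleChains E m := fun m => LinearMap.id - cut p.1 p.2 m
    have hφ : ∀ m c, tupleBoundary E m (φ (m + 1) c) = φ m (tupleBoundary E m c) := fun m c => by
      simp only [φ, LinearMap.sub_apply, LinearMap.id_apply, map_sub, tupleBoundary_cut]
    have hT := tupleBoundary_coneHomotopy (cutPoint p.1 p.2) hφ
      (by simp only [φ, cut, sub_self]) m c'
    refine ⟨cut p.1 p.2 (m + 1) c', ?_, ?_, e + coneHomotopy φ (cutPoint p.1 p.2) (m + 1) c', ?_⟩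
    · have := Submodule.mem_inf.2 ⟨cut_mem_oneSided p.1 p.2 (m + 1) c',
        cut_mem_forall_oneSided p.1 p.2 l h1⟩
      rw [← Finsupp.supported_inter] at this
      refine Finsupp.supported_mono (fun σ hσ q hq => ?_) this
      rcases List.mem_cons.1 hq with rfl | hq
      exacts [hσ.1, hσ.2 q hq]
    · rw [tupleBoundary_cut]
      have : ⨆ i, carriedBy (C i) m ≤ (⨆ i, carriedBy (C i) m).comap (cut p.1 p.2 m) :=
        iSup_le fun i d hd => Submodule.mem_iSup_of_mem i (cut_mem_carriedBy p.1 p.2 (hC i) m d hd)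
      exact this h2
    · have : ⨆ i, carriedBy (C i) m ≤
          (⨆ i, carriedBy (C i) (m + 1)).comap (coneHomotopy φ (cutPoint p.1 p.2) m) :=
        iSup_le fun i d hd => Submodule.mem_iSup_of_mem i (coneHomotopy_mem_carriedBy
          (fun m c hc => Submodule.sub_mem _ hc (cut_mem_carriedBy _ _ (hC i) m c hc))
          (fun m σ hσ => cutPoint_mem _ _ (hC i) hσ) m d hd)
      convert Submodule.add_mem _ he (this h2) using 1
      rw [map_add, hT]
      simp only [φ, LinearMap.sub_apply, LinearMap.id_apply]
      abel

end Cut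

/-! ### Affine simplices -/

/-- A telescoping sum stopped at `i`. It shows both that barycentric coordinates sum to `1` and that
they recover the point of the simplex. -/
theorem sum_sub_mul_ite {k : ℕ} (e : Fin (k + 2) → ℝ) (i : Fin (k + 2)) :
    ∑ j : Fin (k + 1), (e j.succ - e j.castSucc) * (if (j : ℕ) < i then 1 else 0) = e i - e 0 := by
  induction i using Fin.induction with
  | zero => simp
  | succ i ih =>
    have h : ∀ j : Fin (k + 1), (if (j : ℕ) < i.succ then (1 : ℝ) else 0) =
        (if (j : ℕ) < i.castSucc then 1 else 0) + if j = i then 1 else 0 := fun j => by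
      simp only [Fin.val_succ, Fin.val_castSucc, Fin.ext_iff]
      split_ifs <;> first | omega | simp
    simp only [h, mul_add, Finset.sum_add_distrib, ih]
    simp

/-- The barycentric coordinates `tⱼ₊₁ - tⱼ` on `Δᵏ`, with `t₀ = 0` and `tₖ₊₁ = 1`. -/
def baryCoord {k : ℕ} (t : Simplex k) (j : Fin (k + 1)) : ℝ :=
  extend 0 1 t.1 j.succ - extend 0 1 t.1 j.castSucc

theorem baryCoord_nonneg {k : ℕ} (t : Simplex k) (j : Fin (k + 1)) : 0 ≤ baryCoord t j :=
  sub_nonneg.2 (extend_monotone t (Fin.castSucc_lt_succ).le)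

theorem sum_baryCoord {k : ℕ} (t : Simplex k) : ∑ j, baryCoord t j = 1 := by
  have h := sum_sub_mul_ite (extend 0 1 t.1) (Fin.last (k + 1))
  rw [extend_last, extend_zero, sub_zero] at h
  rw [← h]
  exact Finset.sum_congr rfl fun j _ => by rw [if_pos (by simp; omega), mul_one, baryCoord]

theorem continuous_extend {Z : Type*} [TopologicalSpace Z] (a b : Z) {n : ℕ} (k : Fin (n + 2)) :
    Continuous fun x : Fin n → Z => extend a b x k := by
  rcases fin_cases3 k with rfl | rfl | ⟨k, rfl⟩
  · simpa only [extend_zero] using continuous_const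
  · simpa only [extend_last] using continuous_const
  · simpa only [extend_mid] using continuous_apply k

theorem continuous_baryCoord {k : ℕ} (j : Fin (k + 1)) :
    Continuous fun t : Simplex k => baryCoord t j :=
  ((continuous_extend 0 1 _).comp continuous_subtype_val).sub
    ((continuous_extend 0 1 _).comp continuous_subtype_val)

theorem baryCoord_face_self {k : ℕ} (i : Fin (k + 2)) (t : Simplex k) :
    baryCoord (face i t) i = 0 := by
  change extend 0 1 (dup 0 1 i t.1) i.succ - extend 0 1 (dup 0 1 i t.1) i.castSucc = 0
  simp [extend_dup]

/-- With `baryCoord_face_self`: in barycentric coordinates the face map inserts a zero at position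
`i`, so on affine simplices it omits the vertex `i`. -/
theorem baryCoord_face_succAbove {k : ℕ} (i : Fin (k + 2)) (t : Simplex k) (j : Fin (k + 1)) :
    baryCoord (face i t) (i.succAbove j) = baryCoord t j := by
  change extend 0 1 (dup 0 1 i t.1) (i.succAbove j).succ -
    extend 0 1 (dup 0 1 i t.1) (i.succAbove j).castSucc = _
  rw [extend_dup, extend_dup, baryCoord]
  congr 2 <;>
  · ext
    rw [val_predAbove]
    simp only [Fin.succAbove, Fin.lt_def, Fin.val_succ, Fin.val_castSucc]
    split_ifs <;> simp_all <;> omega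

section Realization

variable {E : Type*} [AddCommGroup E] [Module ℝ E] [TopologicalSpace E] [ContinuousAdd E]
  [ContinuousSMul ℝ E]

/-- The affine singular simplex with given vertices. -/
def affineSimplex {k : ℕ} (σ : Fin (k + 1) → E) : C(Simplex k, E) where
  toFun t := ∑ j, baryCoord t j • σ j
  continuous_toFun := continuous_finsetSum _ fun j _ =>
    (continuous_baryCoord j).smul continuous_const

theorem affineSimplex_apply {k : ℕ} (σ : Fin (k + 1) → E) (t : Simplex k) :
    affineSimplex σ t = ∑ j, baryCoord t j • σ j := rfl

theorem affineSimplex_mem {k : ℕ} {σ : Fin (k + 1) → E} {C : Set E} (hC : Convex ℝ C)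
    (hσ : ∀ j, σ j ∈ C) (t : Simplex k) : affineSimplex σ t ∈ C :=
  hC.sum_mem (fun j _ => baryCoord_nonneg t j) (sum_baryCoord t) fun j _ => hσ j

theorem affineSimplex_comp_face {k : ℕ} (σ : Fin (k + 2) → E) (i : Fin (k + 2)) :
    (affineSimplex σ).comp (face i) = affineSimplex fun j => σ (i.succAbove j) := by
  ext t
  rw [ContinuousMap.comp_apply, affineSimplex_apply, affineSimplex_apply,
    Fin.sum_univ_succAbove _ i, baryCoord_face_self, zero_smul, zero_add]
  simp only [baryCoord_face_succAbove]

variable {Z : Type*} [TopologicalSpace Z]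

/-- The singular chain of a chain of tuples: the affine simplices composed with `g`. -/
def realize (g : C(E, Z)) (k : ℕ) : TupleChains E (k + 1) →ₗ[ℤ] Chains Z k :=
  Finsupp.lmapDomain ℤ ℤ fun σ => g.comp (affineSimplex σ)

theorem realize_single (g : C(E, Z)) {k : ℕ} (σ : Fin (k + 1) → E) :
    realize g k (Finsupp.single σ 1) = Finsupp.single (g.comp (affineSimplex σ)) 1 := by
  simp [realize]

/-- A tuple of length `k + 1` becomes a `k`-simplex, so the tuple complex is shifted by one degree.
-/
theorem boundary_realize (g : C(E, Z)) (k : ℕ) (c : TupleChains E (k + 2)) :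
    boundary Z k (realize g (k + 1) c) = realize g k (tupleBoundary E (k + 1) c) := by
  suffices h : boundary Z k ∘ₗ realize g (k + 1) = realize g k ∘ₗ tupleBoundary E (k + 1) from
    LinearMap.congr_fun h c
  refine tupleChains_hom_ext fun σ => ?_
  simp only [LinearMap.comp_apply, realize_single, tupleBoundary_single, map_sum, map_smul,
    boundary, Finsupp.linearCombination_single, one_smul, ContinuousMap.comp_assoc,
    affineSimplex_comp_face]

theorem realize_mem_subChains {g : C(E, Z)} {Y : Set Z} {ι : Type*} {C : ι → Set E}
    (hC : ∀ i, Convex ℝ (C i)) (hg : ∀ i, ∀ x ∈ C i, g x ∈ Y) {k : ℕ} {c : TupleChains E (k + 1)}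
    (hc : c ∈ ⨆ i, carriedBy (C i) (k + 1)) : realize g k c ∈ subChains Y k := by
  have : ⨆ i, carriedBy (C i) (k + 1) ≤ (subChains Y k).comap (realize g k) := by
    refine iSup_le fun i d hd => ?_
    rw [Submodule.mem_comap]
    refine map_mem_of_mem_supported (fun σ hσ => ?_) hd
    rw [realize_single]
    exact Finsupp.single_mem_supported ℤ 1 fun t => hg i _ (affineSimplex_mem (hC i) hσ t)
  exact this hc

theorem realize_mem_relBoundaries {g : C(E, Z)} {Y : Set Z} {ι : Type*} {C : ι → Set E}
    (hC : ∀ i, Convex ℝ (C i)) (hg : ∀ i, ∀ x ∈ C i, g x ∈ Y) {k : ℕ} {c : TupleChains E (k + 1)}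
    {e : TupleChains E (k + 2)}
    (h : c - tupleBoundary E (k + 1) e ∈ ⨆ i, carriedBy (C i) (k + 1)) :
    (Submodule.Quotient.mk (realize g k c) : RelChains Y k) ∈ relBoundaries Y k := by
  refine ⟨Submodule.Quotient.mk (realize g (k + 1) e), ?_⟩
  rw [relBoundary, Submodule.mapQ_apply, boundary_realize, eq_comm, Submodule.Quotient.eq,
    ← map_sub]
  exact realize_mem_subChains hC hg h

end Realization

/-! ### The standard simplex and its faces -/

/-- The `j`-th vertex `(0, …, 0, 1, …, 1)` of `Δⁿ`, with `j` zeros. -/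
def stdVertex (n : ℕ) (j : Fin (n + 1)) : Fin n → ℝ := fun i => if (j : ℕ) ≤ i then 1 else 0

theorem extend_stdVertex {n : ℕ} (j : Fin (n + 1)) (k : Fin (n + 2)) :
    extend 0 1 (stdVertex n j) k = if (j : ℕ) < k then 1 else 0 := by
  rcases fin_cases3 k with rfl | rfl | ⟨k, rfl⟩
  · simp [extend_zero]
  · rw [extend_last, if_pos (by simp; omega)]
  · simp [extend_mid, stdVertex]

theorem affineSimplex_stdVertex {n : ℕ} (t : Simplex n) : affineSimplex (stdVertex n) t = t.1 := by
  funext i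
  have h := sum_sub_mul_ite (extend 0 1 t.1) i.castSucc.succ
  rw [extend_mid, extend_zero, sub_zero] at h
  rw [← h, affineSimplex_apply, Finset.sum_apply]
  refine Finset.sum_congr rfl fun j _ => ?_
  simp [stdVertex, baryCoord]

/-- The affine hull of the `i`-th face of `Δⁿ`. -/
def faceHull (n : ℕ) (i : Fin (n + 1)) : Set (Fin n → ℝ) :=
  {t | extend 0 1 t i.castSucc = extend 0 1 t i.succ}

theorem extend_convexComb {n : ℕ} (x y : Fin n → ℝ) {r s : ℝ} (h : r + s = 1) (k : Fin (n + 2)) :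
    extend 0 1 (r • x + s • y) k = r * extend 0 1 x k + s * extend 0 1 y k := by
  rcases fin_cases3 k with rfl | rfl | ⟨k, rfl⟩
  · simp [extend_zero]
  · simp [extend_last, h]
  · simp [extend_mid]

theorem convex_faceHull (n : ℕ) (i : Fin (n + 1)) : Convex ℝ (faceHull n i) := by
  intro x hx y hy r s _ _ h
  change extend 0 1 _ _ = extend 0 1 _ _
  rw [extend_convexComb x y h, extend_convexComb x y h, show extend 0 1 x _ = _ from hx,
    show extend 0 1 y _ = _ from hy]

/-- Vertex `i` is the only one whose extended coordinates `i` and `i + 1` differ, so omitting it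
leaves a tuple in the `i`-th hull. -/
theorem tupleBoundary_stdVertex_mem (n : ℕ) :
    tupleBoundary _ n (Finsupp.single (stdVertex n) 1) ∈ ⨆ i, carriedBy (faceHull n i) n := by
  rw [tupleBoundary_single]
  refine Submodule.sum_mem _ fun i _ => Submodule.smul_mem _ _ (Submodule.mem_iSup_of_mem i
    (single_mem_carriedBy fun j => ?_))
  change extend 0 1 _ _ = extend 0 1 _ _
  have h : (i.succAbove j : ℕ) ≠ i := fun h => Fin.succAbove_ne i j (Fin.ext h)
  rw [extend_stdVertex, extend_stdVertex, Fin.val_castSucc, Fin.val_succ]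
  split_ifs <;> first | rfl | omega

theorem comp_mem_diag {X : Type*} {a b : X} {n : ℕ} {g : ℝ → X} (h0 : g 0 = a) (h1 : g 1 = b) {i : Fin (n + 1)}
    {t : Fin n → ℝ} (ht : t ∈ faceHull n i) : (fun j => g (t j)) ∈ diag a b n := by
  refine Set.mem_iUnion.2 ⟨i, ?_⟩
  subst h0 h1
  change extend _ _ _ _ = extend _ _ _ _
  rw [extend_comp, extend_comp, show extend 0 1 t _ = _ from ht]

section Paths

variable {X : Type*} [TopologicalSpace X] {a b : X}

/-- The map `ℝⁿ → Xⁿ` with components `g`. -/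
def powMap (n : ℕ) (g : C(ℝ, X)) : C(Fin n → ℝ, Fin n → X) where
  toFun t i := g (t i)
  continuous_toFun := continuous_pi fun i => g.continuous.comp (continuous_apply i)

theorem pathSimplex_eq (n : ℕ) (γ : Path a b) :
    pathSimplex n γ = (powMap n γ.extend).comp (affineSimplex (stdVertex n)) := by
  ext t i
  rw [ContinuousMap.comp_apply, affineSimplex_stdVertex]
  exact (γ.extend_apply (t.2.2 i)).symm

theorem mk_eq_zero_of_mem {Z : Type*} [TopologicalSpace Z] {Y : Set Z} {n : ℕ}
    {x : relCycles Y n} (h : x.1 ∈ relBoundaries Y n) :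
    (Submodule.Quotient.mk x : RelHomology Y n) = 0 :=
  (Submodule.Quotient.mk_eq_zero _).2 h

/-! ### Homotopy invariance -/

/-- The inclusion `x ↦ (s, x)` on tuples. -/
def levelMap {E : Type*} (s : ℝ) (m : ℕ) : TupleChains E m →ₗ[ℤ] TupleChains (ℝ × E) m :=
  Finsupp.lmapDomain ℤ ℤ fun σ j => (s, σ j)

theorem levelMap_single {E : Type*} (s : ℝ) {m : ℕ} (σ : Fin m → E) :
    levelMap s m (Finsupp.single σ 1) = Finsupp.single (fun j => (s, σ j)) 1 := by
  simp [levelMap]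

theorem tupleBoundary_levelMap {E : Type*} (s : ℝ) (m : ℕ) (c : TupleChains E (m + 1)) :
    tupleBoundary _ m (levelMap s (m + 1) c) = levelMap s m (tupleBoundary _ m c) := by
  suffices h : tupleBoundary _ m ∘ₗ levelMap s (m + 1) = levelMap s m ∘ₗ tupleBoundary E m from
    LinearMap.congr_fun h c
  refine tupleChains_hom_ext fun σ => ?_
  simp only [LinearMap.comp_apply, levelMap_single, tupleBoundary_single, map_sum, map_smul]

theorem levelMap_mem_carriedBy {E : Type*} (s : ℝ) {C : Set E} {m : ℕ} {c : TupleChains E m}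
    (hc : c ∈ carriedBy C m) : levelMap s m c ∈ carriedBy (Set.univ ×ˢ C) m := by
  refine map_mem_of_mem_supported (fun σ hσ => ?_) hc
  rw [levelMap_single]
  exact single_mem_carriedBy fun j => ⟨trivial, hσ j⟩

/-- The prism: the two ends of the cylinder over a relative cycle are homologous. -/
theorem exists_prism {E : Type*} {ι : Type*} (C : ι → Set E) {m : ℕ} (c : TupleChains E (m + 1))
    (hc : tupleBoundary E m c ∈ ⨆ i, carriedBy (C i) m) :
    ∃ e, levelMap 1 (m + 1) c - levelMap 0 (m + 1) c - tupleBoundary (ℝ × E) (m + 1) e ∈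
      ⨆ i, carriedBy (Set.univ ×ˢ C i : Set (ℝ × E)) (m + 1) := by
  let φ : ∀ m, TupleChains E m →ₗ[ℤ] TupleChains (ℝ × E) m := fun m => levelMap 1 m - levelMap 0 m
  -- Any point over the tuple would do; this one lies in `univ ×ˢ C` whenever the tuple lies in `C`.
  let q : ∀ m, (Fin (m + 1) → E) → ℝ × E := fun m σ => (0, σ 0)
  have hφ : ∀ m c, tupleBoundary _ m (φ (m + 1) c) = φ m (tupleBoundary _ m c) := fun m c => by
    simp only [φ, LinearMap.sub_apply, map_sub, tupleBoundary_levelMap]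
  -- Both levels send the empty tuple to the empty tuple.
  have h0 : φ 0 = 0 := tupleChains_hom_ext fun σ => by
    simp only [φ, LinearMap.sub_apply, levelMap_single, LinearMap.zero_apply]
    rw [sub_eq_zero]
    congr 1
    exact Subsingleton.elim _ _
  refine ⟨coneHomotopy φ q (m + 1) c, ?_⟩
  rw [tupleBoundary_coneHomotopy q hφ h0, ← LinearMap.sub_apply, sub_sub_cancel]
  have : ⨆ i, carriedBy (C i) m ≤ (⨆ i, carriedBy (Set.univ ×ˢ C i : Set (ℝ × E)) (m + 1)).comap
      (coneHomotopy φ q m) :=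
    iSup_le fun i d hd => Submodule.mem_iSup_of_mem i (coneHomotopy_mem_carriedBy
      (fun m c hc => Submodule.sub_mem _ (levelMap_mem_carriedBy 1 hc)
        (levelMap_mem_carriedBy 0 hc))
      (fun m σ hσ => Set.mk_mem_prod (Set.mem_univ _) (hσ 0)) m d hd)
  exact this hc

theorem affineSimplex_level {E : Type*} [AddCommGroup E] [Module ℝ E] [TopologicalSpace E]
    [ContinuousAdd E] [ContinuousSMul ℝ E] (s : ℝ) {k : ℕ} (σ : Fin (k + 1) → E) (t : Simplex k) :
    affineSimplex (fun j => (s, σ j)) t = (s, affineSimplex σ t) := by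
  ext
  · simp only [affineSimplex_apply, Prod.fst_sum, Prod.smul_fst, ← Finset.sum_smul,
      sum_baryCoord, one_smul]
  · simp only [affineSimplex_apply, Prod.snd_sum, Prod.smul_snd]

/-- The map `ℝ × ℝⁿ → Xⁿ` defined by a homotopy of paths. -/
def homotopyMap (n : ℕ) {γ γ' : Path a b} (H : γ.Homotopy γ') :
    C(ℝ × (Fin n → ℝ), Fin n → X) where
  toFun p i := H (Set.projIcc 0 1 zero_le_one p.1, Set.projIcc 0 1 zero_le_one (p.2 i))
  continuous_toFun := by fun_prop

theorem homotopyMap_comp_affineSimplex (n : ℕ) {γ γ' : Path a b} (H : γ.Homotopy γ') (s : ℝ)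
    (δ : Path a b) (h : ∀ t, H (Set.projIcc 0 1 zero_le_one s, t) = δ t) :
    (homotopyMap n H).comp (affineSimplex fun j => (s, stdVertex n j)) = pathSimplex n δ := by
  ext t i
  rw [ContinuousMap.comp_apply, affineSimplex_level, affineSimplex_stdVertex]
  refine (h _).trans (congrArg δ ?_)
  exact Set.projIcc_of_mem _ (t.2.2 i)

theorem pathClass_eq_of_homotopy (n : ℕ) {γ γ' : Path a b} (H : γ.Homotopy γ') :
    pathClass n γ = pathClass n γ' := by
  obtain ⟨e, he⟩ := exists_prism (faceHull n) _ (tupleBoundary_stdVertex_mem n)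
  have h := realize_mem_relBoundaries (g := homotopyMap n H) (Y := diag a b n)
    (fun i => convex_univ.prod (convex_faceHull n i)) (fun i p hp => comp_mem_diag
      (g := fun s => H (Set.projIcc 0 1 zero_le_one p.1, Set.projIcc 0 1 zero_le_one s))
      (by simp) (by simp) hp.2) he
  rw [map_sub, levelMap_single, levelMap_single, realize_single, realize_single,
    homotopyMap_comp_affineSimplex n H 1 γ' (by simp),
    homotopyMap_comp_affineSimplex n H 0 γ (by simp)] at h
  symm
  rw [← sub_eq_zero, pathClass, pathClass, ← Submodule.Quotient.mk_sub]
  exact mk_eq_zero_of_mem h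

end Paths

/-! ### Cancellation in the alternating sum -/

section Concat

variable {X : Type*} [TopologicalSpace X] {a b : X}

/-- The path that follows `α (k - 1)`, …, `α 0`, and then `γ`. -/
def concat (γ : Path a b) (α : ℕ → Path a a) : ℕ → Path a b
  | 0 => γ
  | k + 1 => (α k).trans (concat γ α k)

/-- The parameters at which `concat γ α k` changes from one path to the next. -/
def breakpoints : ℕ → List ℝ
  | 0 => []
  | k + 1 => 1 / 2 :: (breakpoints k).map fun x => (x + 1) / 2

/-- Between two consecutive breakpoints, `concat γ α k` depends on one `α j` only. -/
theorem exists_concat_eqOn (γ : Path a b) (k : ℕ) {s : Set ℝ}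
    (hs : ∀ x ∈ breakpoints k, s ⊆ Set.Iic x ∨ s ⊆ Set.Ici x) :
    ∃ j, ∀ α α' : ℕ → Path a a, α j = α' j →
      Set.EqOn (concat γ α k).extend (concat γ α' k).extend s := by
  induction k generalizing s with
  -- The index is arbitrary: no loop occurs in `concat γ α 0`.
  | zero => exact ⟨0, fun _ _ _ _ _ => rfl⟩
  | succ k ih =>
    rcases hs _ List.mem_cons_self with h | h
    · refine ⟨k, fun α α' hα t ht => ?_⟩
      simp only [concat, Path.extend_trans_of_le_half _ _ (h ht), hα]
    -- On the second half the concatenation is the shorter one at `2 * t - 1`, which undoes the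
    -- rescaling `(x + 1) / 2` of the breakpoints.
    · obtain ⟨j, hj⟩ := ih (s := (fun t => 2 * t - 1) '' s) fun x hx => by
        refine (hs _ (List.mem_cons_of_mem _ (List.mem_map_of_mem hx))).imp ?_ ?_ <;>
        · rintro h _ ⟨t, ht, rfl⟩
          have := h ht
          simp only [Set.mem_Iic, Set.mem_Ici] at this ⊢
          linarith
      refine ⟨j, fun α α' hα t ht => ?_⟩
      simp only [concat, Path.extend_trans_of_half_le _ _ (h ht)]
      exact hj α α' hα ⟨t, ht, rfl⟩

/-- The loops `α i` with `i ∈ I`, the others being replaced by the constant loop. -/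
def select {m : ℕ} (α : Fin m → Path a a) (I : Finset (Fin m)) (j : ℕ) : Path a a :=
  if h : j < m then (if (⟨j, h⟩ : Fin m) ∈ I then α ⟨j, h⟩ else Path.refl a) else Path.refl a

theorem select_congr {m : ℕ} (α : Fin m → Path a a) {I J : Finset (Fin m)} {j : ℕ}
    (h : ∀ i : Fin m, (i : ℕ) = j → (i ∈ I ↔ i ∈ J)) : select α I j = select α J j := by
  unfold select
  split_ifs with h1 h2 h3 h3
  exacts [rfl, absurd ((h ⟨j, h1⟩ rfl).1 h2) h3, absurd ((h ⟨j, h1⟩ rfl).2 h3) h2, rfl, rfl]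

/-- Toggling membership of `l` is a fixed-point-free involution that pairs terms of opposite sign.
-/
theorem sum_neg_one_pow_card_smul_eq_zero {ι M : Type*} [Fintype ι] [DecidableEq ι]
    [AddCommGroup M] (f : Finset ι → M) (l : ι) (h : ∀ I, l ∉ I → f (insert l I) = f I) :
    ∑ I : Finset ι, (-1 : ℤ) ^ I.card • f I = 0 := by
  refine Finset.sum_involution (fun I _ => symmDiff I {l}) (fun I _ => ?_) (fun I _ _ hI => ?_)
    (fun _ _ => Finset.mem_univ _) fun I _ => symmDiff_symmDiff_cancel_right _ _
  · by_cases hl : l ∈ I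
    · obtain ⟨J, hJ, rfl⟩ : ∃ J, l ∉ J ∧ insert l J = I :=
        ⟨I.erase l, Finset.notMem_erase l I, Finset.insert_erase hl⟩
      have : symmDiff (insert l J) {l} = J := by
        ext x; by_cases hx : x = l <;> simp [Finset.mem_symmDiff, hx, hJ]
      rw [this, h J hJ, Finset.card_insert_of_notMem hJ, pow_succ]
      simp
    · have : symmDiff I {l} = insert l I := by
        ext x; by_cases hx : x = l <;> simp [Finset.mem_symmDiff, hx, hl]
      rw [this, h I hl, Finset.card_insert_of_notMem hl, pow_succ]
      simp
  · have := congrArg (l ∈ ·) hI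
    simp [Finset.mem_symmDiff] at this

/-- The hyperplanes of `ℝⁿ` on which a coordinate is one of the given numbers. -/
def coordHyperplanes (n : ℕ) (B : List ℝ) : List (((Fin n → ℝ) →ₗ[ℝ] ℝ) × ℝ) :=
  (List.finRange n).flatMap fun i => B.map fun x => (LinearMap.proj i, x)

theorem comp_affineSimplex_congr {n k : ℕ} {g g' : C(ℝ, X)} {σ : Fin (k + 1) → Fin n → ℝ}
    (h : ∀ i, Set.EqOn g g' (convexHull ℝ (Set.range fun j => σ j i))) :
    (powMap n g).comp (affineSimplex σ) = (powMap n g').comp (affineSimplex σ) := by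
  ext t i
  refine h i ?_
  have hC : Convex ℝ ((LinearMap.proj i : (Fin n → ℝ) →ₗ[ℝ] ℝ) ⁻¹'
      convexHull ℝ (Set.range fun j => σ j i)) :=
    (convex_convexHull ℝ _).linear_preimage _
  exact affineSimplex_mem hC (fun j => subset_convexHull ℝ _ ⟨j, rfl⟩) t

theorem sum_realize_concat_single {n k : ℕ} (γ : Path a b) (α : Fin (n + 1) → Path a a)
    {σ : Fin (k + 1) → Fin n → ℝ}
    (hσ : ∀ p ∈ coordHyperplanes n (breakpoints (n + 1)), OneSided p.1 p.2 σ) :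
    ∑ I : Finset (Fin (n + 1)), (-1 : ℤ) ^ I.card •
      realize (powMap n (concat γ (select α I) (n + 1)).extend) k (Finsupp.single σ 1) = 0 := by
  have h : ∀ i : Fin n, ∃ j, ∀ α α' : ℕ → Path a a, α j = α' j →
      Set.EqOn (concat γ α (n + 1)).extend (concat γ α' (n + 1)).extend
        (convexHull ℝ (Set.range fun j => σ j i)) := fun i => by
    refine exists_concat_eqOn γ (n + 1) fun x hx => ?_
    refine (hσ (LinearMap.proj i, x) (List.mem_flatMap.2 ⟨i, List.mem_finRange i,
      List.mem_map_of_mem hx⟩)).imp (fun h => ?_) fun h => ?_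
    · exact convexHull_min (Set.range_subset_iff.2 h) (convex_Iic x)
    · exact convexHull_min (Set.range_subset_iff.2 h) (convex_Ici x)
  choose j hj using h
  -- Pigeonhole: `n` coordinates see at most `n` of the `n + 1` loops.
  obtain ⟨l, hl⟩ : ∃ l : Fin (n + 1), ∀ i, (l : ℕ) ≠ j i := by
    by_contra! hcon
    choose f hf using hcon
    have hinj : Function.Injective f := fun x y hxy => Fin.ext (by rw [hf x, hf y, hxy])
    simpa using Fintype.card_le_of_injective f hinj
  refine sum_neg_one_pow_card_smul_eq_zero _ l fun I _ => ?_
  rw [realize_single, realize_single]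
  congr 1
  refine comp_affineSimplex_congr fun i => hj i _ _ (select_congr α fun r hr => ?_)
  rw [Finset.mem_insert, or_iff_right]
  rintro rfl
  exact hl i hr

theorem sum_realize_concat {n k : ℕ} (γ : Path a b) (α : Fin (n + 1) → Path a a)
    {c : TupleChains (Fin n → ℝ) (k + 1)}
    (hc : c ∈ Finsupp.supported ℤ ℤ {σ : Fin (k + 1) → Fin n → ℝ |
      ∀ p ∈ coordHyperplanes n (breakpoints (n + 1)), OneSided p.1 p.2 σ}) :
    ∑ I : Finset (Fin (n + 1)), (-1 : ℤ) ^ I.card •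
      realize (powMap n (concat γ (select α I) (n + 1)).extend) k c = 0 := by
  have h := map_mem_of_mem_supported (N := ⊥) (f := ∑ I : Finset (Fin (n + 1)),
    (-1 : ℤ) ^ I.card • realize (powMap n (concat γ (select α I) (n + 1)).extend) k)
    (fun σ hσ => ?_) hc
  · simpa only [Submodule.mem_bot, LinearMap.sum_apply, LinearMap.smul_apply] using h
  · simpa only [Submodule.mem_bot, LinearMap.sum_apply, LinearMap.smul_apply] using
      sum_realize_concat_single γ α hσ

/-- The chain `z` and the error chain `e` live in `ℝⁿ` and are chosen before any path, so the same
`z` represents every term and the cancellation takes place on chains. -/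
theorem sum_pathClass_concat (n : ℕ) (γ : Path a b) (α : Fin (n + 1) → Path a a) :
    ∑ I : Finset (Fin (n + 1)),
      (-1 : ℤ) ^ I.card • pathClass n (concat γ (select α I) (n + 1)) = 0 := by
  obtain ⟨z, hz, -, e, he⟩ := exists_forall_oneSided (convex_faceHull n)
    (coordHyperplanes n (breakpoints (n + 1))) _ (tupleBoundary_stdVertex_mem n)
  have key : ∀ δ : Path a b, (Submodule.Quotient.mk (Finsupp.single (pathSimplex n δ) 1 -
      realize (powMap n δ.extend) n z) : RelChains (diag a b n) n) ∈
        relBoundaries (diag a b n) n := fun δ => by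
    rw [pathSimplex_eq, ← realize_single, ← map_sub]
    exact realize_mem_relBoundaries (convex_faceHull n)
      (fun i t ht => comp_mem_diag δ.extend_zero δ.extend_one ht) he
  let δ : Finset (Fin (n + 1)) → Path a b := fun I => concat γ (select α I) (n + 1)
  have hsum : ∑ I : Finset (Fin (n + 1)), (-1 : ℤ) ^ I.card • pathClass n (δ I) =
      Submodule.Quotient.mk (∑ I : Finset (Fin (n + 1)), (-1 : ℤ) ^ I.card •
        (⟨Submodule.Quotient.mk (Finsupp.single (pathSimplex n (δ I)) (1 : ℤ)),
          pathSimplex_mem_relCycles n (δ I)⟩ : relCycles (diag a b n) n)) := by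
    simp only [pathClass, ← Submodule.mkQ_apply, map_sum, map_smul]
  rw [hsum]
  refine mk_eq_zero_of_mem ?_
  have h := Submodule.sum_mem (relBoundaries (diag a b n) n) (t := Finset.univ)
    (f := fun I : Finset (Fin (n + 1)) => (-1 : ℤ) ^ I.card • (Submodule.Quotient.mk
      (Finsupp.single (pathSimplex n (δ I)) 1 - realize (powMap n (δ I).extend) n z) :
        RelChains (diag a b n) n)) fun I _ => Submodule.smul_mem _ _ (key (δ I))
  convert h using 1
  have h0 := congrArg (Submodule.mkQ (subChains (diag a b n) n)) (sum_realize_concat γ α hz)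
  simp only [map_sum, map_smul, map_zero] at h0
  simp only [← Submodule.mkQ_apply, map_sub, smul_sub, Finset.sum_sub_distrib, δ, h0, sub_zero,
    AddSubmonoidClass.coe_finsetSum, Submodule.coe_smul]

end Concat

/-! ### Ordered products over subsets and powers of the augmentation ideal -/

/-- Padding with `1` gives all the products the same length, as in `concat` with constant loops and
in the expansion of a product of `n + 1` factors. -/
theorem prod_map_sort {M : Type*} [Monoid M] {m : ℕ} (f : Fin m → M) (I : Finset (Fin m)) :
    ((I.sort (· ≤ ·)).map f).prod = (List.ofFn fun i => if i ∈ I then f i else 1).prod := by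
  have h : I.sort (· ≤ ·) = (List.finRange m).filter (· ∈ I) := by
    have hn : ((List.finRange m).filter (· ∈ I)).Nodup := (List.nodup_finRange m).filter _
    have hI : ((List.finRange m).filter (· ∈ I)).toFinset = I := by
      ext i; simp
    have hs := (List.toFinset_sort (· ≤ ·) hn).2
      (((List.pairwise_lt_finRange m).imp fun h => h.le).filter _)
    rwa [hI] at hs
  rw [h, List.ofFn_eq_map]
  induction List.finRange m with
  | nil => rfl
  | cons i l ih => by_cases hi : i ∈ I <;> simp [hi, ih]

theorem prod_ofFn_one_sub {A : Type*} [Ring A] {m : ℕ} (x : Fin m → A) :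
    (List.ofFn fun i => 1 - x i).prod = ∑ I : Finset (Fin m),
      (-1 : ℤ) ^ I.card • (List.ofFn fun i => if i ∈ I then x i else 1).prod := by
  have h := (MultilinearMap.mkPiAlgebraFin ℤ m A).map_add_univ (fun i => -x i) fun _ => 1
  rw [MultilinearMap.mkPiAlgebraFin_apply] at h
  convert h using 1
  · congr 2
    funext i
    rw [Pi.add_apply, sub_eq_neg_add]
  · refine Finset.sum_congr rfl fun I _ => ?_
    -- Pulls the sign out of each factor indexed by `I`, giving `(-1) ^ I.card`.
    have h' := (MultilinearMap.mkPiAlgebraFin ℤ m A).map_piecewise_smul (fun _ => (-1 : ℤ))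
      (fun i => if i ∈ I then x i else 1) I
    rw [Finset.prod_const, MultilinearMap.mkPiAlgebraFin_apply] at h'
    rw [MultilinearMap.mkPiAlgebraFin_apply] at h' ⊢
    rw [← h']
    congr 2
    funext i
    by_cases hi : i ∈ I <;> simp [Finset.piecewise, hi]

theorem mem_span_of_mem_augIdeal {G : Type*} [Group G] {v : MonoidAlgebra ℤ G}
    (hv : v ∈ augIdeal G) :
    v ∈ Submodule.span ℤ (Set.range fun g : G => 1 - MonoidAlgebra.of ℤ G g) := by
  -- Subtracting the augmentation turns `k • g` into `-k • (1 - g)`.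
  have h : ∀ w : MonoidAlgebra ℤ G, w - (MonoidAlgebra.lift ℤ ℤ G 1 w) • (1 : MonoidAlgebra ℤ G) ∈
      Submodule.span ℤ (Set.range fun g : G => 1 - MonoidAlgebra.of ℤ G g) := fun w => by
    induction w using MonoidAlgebra.induction_linear with
    | zero => simp
    | add x y hx hy =>
      convert Submodule.add_mem _ hx hy using 1
      rw [map_add, add_smul]
      abel
    | single g k =>
      convert Submodule.smul_mem _ (-k) (Submodule.subset_span (Set.mem_range_self g)) using 1
      rw [MonoidAlgebra.lift_single, MonoidHom.one_apply, smul_sub, MonoidAlgebra.of_apply,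
        neg_smul, neg_smul, MonoidAlgebra.smul_single, smul_eq_mul, mul_one]
      abel
  have := h v
  rwa [show MonoidAlgebra.lift ℤ ℤ G 1 v = 0 from hv, zero_smul, sub_zero] at this

/-- The exponent is positive because the zeroth powers differ: the whole ring on the left, only `ℤ ·
1` on the right. -/
theorem mem_span_pow_of_mem_augIdeal_pow {G : Type*} [Group G] {m : ℕ} {v : MonoidAlgebra ℤ G}
    (hv : v ∈ augIdeal G ^ (m + 1)) :
    v ∈ Submodule.span ℤ (Set.range fun g : G => 1 - MonoidAlgebra.of ℤ G g) ^ (m + 1) := by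
  induction m generalizing v with
  | zero =>
    rw [zero_add, Submodule.pow_one] at hv ⊢
    exact mem_span_of_mem_augIdeal hv
  | succ m ih =>
    rw [Submodule.pow_succ] at hv ⊢
    refine Submodule.smul_induction_on hv (fun x hx y hy => ?_) fun x y hx hy =>
      Submodule.add_mem _ hx hy
    exact Submodule.mul_mem_mul (ih hx) (mem_span_of_mem_augIdeal hy)

/-! ### The right action and the augmentation submodule -/

section Action

variable {X : Type*} [TopologicalSpace X] {a b : X}

theorem rightMul_single_of (γ : Path.Homotopic.Quotient a b) (g : FundamentalGroup X a) :
    rightMul a b (Finsupp.single γ 1) (MonoidAlgebra.of ℤ _ g) =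
      Finsupp.single (pathMul γ g) 1 := by
  rw [rightMul, Finsupp.linearCombination_single, one_smul, LinearMap.comp_apply,
    MonoidAlgebra.of_apply]
  change Finsupp.linearCombination ℤ _ (Finsupp.single g 1) = _
  rw [Finsupp.linearCombination_single, one_smul]

theorem pathMul_one (γ : Path.Homotopic.Quotient a b) : pathMul γ 1 = γ :=
  Path.Homotopic.Quotient.refl_trans γ

/-- The orders agree: the last loop is followed first and is the rightmost factor. -/
theorem mk_concat (γ : Path a b) (β : ℕ → Path a a) (k : ℕ) :
    Path.Homotopic.Quotient.mk (concat γ β k) = pathMul (Path.Homotopic.Quotient.mk γ)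
      (List.ofFn fun i : Fin k =>
        FundamentalGroup.fromPath (Path.Homotopic.Quotient.mk (β i))).prod := by
  induction k with
  | zero => rw [List.ofFn_zero, List.prod_nil, pathMul_one]; rfl
  | succ k ih =>
    rw [List.ofFn_succ', List.concat_eq_append, List.prod_append, List.prod_singleton,
      pathMul_mul]
    simp only [Fin.val_castSucc, Fin.val_last]
    rw [← ih]
    exact Path.Homotopic.Quotient.mk_trans _ _

theorem mk_concat_select {m : ℕ} (γ : Path a b) (α : Fin m → Path a a) (I : Finset (Fin m)) :
    Path.Homotopic.Quotient.mk (concat γ (select α I) m) =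
      pathMul (Path.Homotopic.Quotient.mk γ) ((I.sort (· ≤ ·)).map fun i =>
        FundamentalGroup.fromPath (Path.Homotopic.Quotient.mk (α i))).prod := by
  rw [mk_concat, prod_map_sort]
  congr 3
  funext i
  rw [select, dif_pos i.2]
  split_ifs <;> rfl

open scoped Pointwise in
theorem linearCombination_eq_zero_of_mem_augSubmodule {M : Type*} [AddCommGroup M] {n : ℕ}
    {F : Path.Homotopic.Quotient a b → M}
    (hF : ∀ (γ : Path.Homotopic.Quotient a b) (α : Fin (n + 1) → FundamentalGroup X a),
      ∑ I : Finset (Fin (n + 1)),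
        (-1 : ℤ) ^ I.card • F (pathMul γ ((I.sort (· ≤ ·)).map α).prod) = 0) :
    augSubmodule a b (n + 1) ≤ LinearMap.ker (Finsupp.linearCombination ℤ F) := by
  refine Submodule.map₂_le.2 fun u hu v hv => ?_
  clear hu
  rw [LinearMap.mem_ker]
  induction u using Finsupp.induction_linear with
  | zero => simp
  | add u w hu hw => rw [map_add, LinearMap.add_apply, map_add, hu, hw, add_zero]
  | single γ k =>
    rw [← mul_one k, ← smul_eq_mul, ← Finsupp.smul_single, map_smul, LinearMap.smul_apply,
      map_smul]
    suffices h : Finsupp.linearCombination ℤ F (rightMul a b (Finsupp.single γ 1) v) = 0 by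
      rw [h, smul_zero]
    have hv' := mem_span_pow_of_mem_augIdeal_pow hv
    rw [Submodule.span_pow] at hv'
    -- On a generator `∏ (1 - αᵢ)` the value is exactly the alternating sum of `hF`.
    have hle : Submodule.span ℤ ((Set.range fun g : FundamentalGroup X a =>
        1 - MonoidAlgebra.of ℤ _ g) ^ (n + 1)) ≤
        LinearMap.ker (Finsupp.linearCombination ℤ F ∘ₗ rightMul a b (Finsupp.single γ 1)) := by
      rw [Submodule.span_le]
      intro w hw
      obtain ⟨f, rfl⟩ := Set.mem_pow.1 hw
      choose α hα using fun i => (f i).2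
      rw [SetLike.mem_coe, LinearMap.mem_ker, ← hF γ α]
      simp only [← hα]
      rw [prod_ofFn_one_sub]
      simp only [← prod_map_sort, map_sum, map_smul, LinearMap.comp_apply]
      refine Finset.sum_congr rfl fun I _ => ?_
      have h : (List.map (fun i => MonoidAlgebra.of ℤ (FundamentalGroup X a) (α i))
          (I.sort (· ≤ ·))).prod = MonoidAlgebra.of ℤ _ ((I.sort (· ≤ ·)).map α).prod := by
        rw [map_list_prod, List.map_map]
        rfl
      rw [h, rightMul_single_of, Finsupp.linearCombination_single, one_smul]
    exact hle hv'

end Action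

end PathHomology

end

theorem mainTheorem1 {X : Type*} [TopologicalSpace X] (a b : X) (n : ℕ) (hn : 1 ≤ n) :
    (∃! F : Path.Homotopic.Quotient a b →
        PathHomology.RelHomology (PathHomology.diag a b n) n,
      ∀ γ : Path a b, F (Path.Homotopic.Quotient.mk γ) = PathHomology.pathClass n γ) ∧
    ∀ F : Path.Homotopic.Quotient a b →
        PathHomology.RelHomology (PathHomology.diag a b n) n,
      (∀ γ : Path a b, F (Path.Homotopic.Quotient.mk γ) = PathHomology.pathClass n γ) →
      (∀ (γ : Path.Homotopic.Quotient a b) (α : Fin (n + 1) → FundamentalGroup X a),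
        ∑ I : Finset (Fin (n + 1)),
          (-1 : ℤ) ^ I.card • F (PathHomology.pathMul γ ((I.sort (· ≤ ·)).map α).prod) = 0) ∧
      ∃! Fbar : ((Path.Homotopic.Quotient a b →₀ ℤ) ⧸ PathHomology.augSubmodule a b (n + 1)) →ₗ[ℤ]
          PathHomology.RelHomology (PathHomology.diag a b n) n,
        ∀ γ : Path.Homotopic.Quotient a b,
          Fbar (Submodule.Quotient.mk (Finsupp.single γ 1)) = F γ := by
  refine ⟨⟨Quotient.lift (PathHomology.pathClass n) fun γ γ' ⟨H⟩ =>
    PathHomology.pathClass_eq_of_homotopy n H, fun γ => rfl, fun F hF => funext fun γ => ?_⟩,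
    fun F hF => ?_⟩
  · induction γ using Path.Homotopic.Quotient.ind with
    | mk γ => exact hF γ
  · have hrel : ∀ (γ : Path.Homotopic.Quotient a b) (α : Fin (n + 1) → FundamentalGroup X a),
        ∑ I : Finset (Fin (n + 1)),
          (-1 : ℤ) ^ I.card • F (PathHomology.pathMul γ ((I.sort (· ≤ ·)).map α).prod) = 0 := by
      intro γ α
      obtain ⟨γ, rfl⟩ := Path.Homotopic.Quotient.mk_surjective γ
      choose β hβ using fun i => Path.Homotopic.Quotient.mk_surjective (α i).toPath
      obtain rfl : (fun i => FundamentalGroup.fromPath (Path.Homotopic.Quotient.mk (β i))) = α :=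
        funext hβ
      rw [← PathHomology.sum_pathClass_concat n γ β]
      exact Finset.sum_congr rfl fun I _ => by rw [← hF, PathHomology.mk_concat_select]
    refine ⟨hrel, Submodule.liftQ _ (Finsupp.linearCombination ℤ F)
      (PathHomology.linearCombination_eq_zero_of_mem_augSubmodule hrel), fun γ => ?_,
      fun G hG => ?_⟩
    · change Submodule.liftQ _ _ _ (Submodule.Quotient.mk _) = _
      rw [Submodule.liftQ_apply, Finsupp.linearCombination_single, one_smul]
    · refine Submodule.linearMap_qext _ (Finsupp.lhom_ext' fun γ => LinearMap.ext_ring ?_)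
      change G (Submodule.Quotient.mk (Finsupp.single γ 1)) =
        Finsupp.linearCombination ℤ F (Finsupp.single γ 1)
      rw [hG, Finsupp.linearCombination_single, one_smul]
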